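/- Let $n\ge 1$, let $f\in\mathbb{R}^n$ be a deterministic vector, and let $\xi_1,\dots,\xi_n$ be independent real random variables such that, for some $\sigma\ge 0$, \[ \log \mathbb{E}\big[e^{\lambda \xi_i}\big]\le \frac{\lambda^2\sigma^2}{2}\qquad\text{for all }\lambda\in\mathbb{R}\text{ and } i=1,\dots,n \] (in particular these expectations are finite, and the $\xi_i$ are centered). One observes $Y=f+\xi$ with $\xi=(\xi_1,\dots,\xi_n)$. Let $\{S_m,\ m\in\mathcal{M}\}$ be an arbitrary family of linear subspaces of $\mathbb{R}^n$, let $D_m=\dim S_m$, let $\hat f_m=\Pi_{S_m}Y$ be the least-squares estimator in $S_m$, where $\Pi_{S}$ is the orthogonal projection onto $S$, and let $\{\Delta_m,\ m\in\mathcal{M}\}$ be nonnegative numbers such that $\Sigma=\sum_{m\in\mathcal{M}}e^{-\Delta_m}<+\infty$. Let $K>1$ and $\kappa=18$, and let $\mathrm{pen}:\mathcal{M}\to\mathbb{R}_+$ satisfy \[ \mathrm{pen}(m)\ge K\kappa^2\sigma^2\,(D_m+\Delta_m)\qquad\text{for all } m\in\mathcal{M}. \] Let $\hat m$ be a random element of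 $\mathcal{M}$ that almost surely minimizes $\mathrm{crit}(m)=|Y-\hat f_m|_2^2+\mathrm{pen}(m)$ over $m\in\mathcal{M}$, where $|\cdot|_2$ is the Euclidean norm. Then $|f-\hat f_{\hat m}|_2^2$ and all the $|f-\hat f_m|_2^2$, $m\in\mathcal{M}$, are integrable, and \[ \mathbb{E}\big[|f-\hat f_{\hat m}|_2^2\big]\le \frac{K(K^2+K-1)}{(K-1)^3}\,\inf_{m\in\mathcal{M}}\Big(\mathbb{E}\big[|f-\hat f_m|_2^2\big]+\mathrm{pen}(m)\Big)+R, \qquad R=\frac{K^3}{(K-1)^2}\,\kappa^2\sigma^2\,\Sigma . \] No condition relating the subspaces $S_m$ to the canonical basis of $\mathbb{R}^n$ is required. -/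

import Mathlib

open MeasureTheory ProbabilityTheory

namespace ModelSelection

noncomputable section

/-- The numerical constant `κ = 18`. -/
def kappa : ℝ := 18

/-- The Bernstein-type condition with parameters `σ` and `c` on the Laplace transform of a real
random variable `X`: for every `t` in the interval `(-1/c, 1/c)` (the whole line if `c = 0`), the
expectation of `exp (t X)` is finite and its logarithm is at most `t² σ² / (2 (1 - |t| c))`. -/
def LaplaceBound {Ω : Type*} [MeasurableSpace Ω] (P : Measure Ω) (X : Ω → ℝ) (σ c : ℝ) : Prop :=
  ∀ t : ℝ, |t| * c < 1 →
    Integrable (fun ω => Real.exp (t * X ω)) P ∧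
      Real.log (∫ ω, Real.exp (t * X ω) ∂P) ≤ t ^ 2 * σ ^ 2 / (2 * (1 - |t| * c))

/-- The observed vector `Y = f + ξ` of the regression model `Y_i = f_i + ξ_i`. -/
def obs {Ω : Type*} {n : ℕ} (f : EuclideanSpace ℝ (Fin n)) (ξ : Fin n → Ω → ℝ) (ω : Ω) :
    EuclideanSpace ℝ (Fin n) :=
  WithLp.toLp 2 (fun i => f i + ξ i ω)

/-- The least-squares estimator in the model `S`: the orthogonal projection of the data `y`
onto `S`. -/
def lse {n : ℕ} (S : Submodule ℝ (EuclideanSpace ℝ (Fin n))) (y : EuclideanSpace ℝ (Fin n)) :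
    EuclideanSpace ℝ (Fin n) :=
  S.starProjection y

/-- The penalized least-squares criterion `crit(m) = |y - f̂_m|² + pen(m)` for the data `y`. -/
def crit {n : ℕ} {M : Type*} (S : M → Submodule ℝ (EuclideanSpace ℝ (Fin n))) (pen : M → ℝ)
    (y : EuclideanSpace ℝ (Fin n)) (m : M) : ℝ :=
  ‖y - lse (S m) y‖ ^ 2 + pen m

end

end ModelSelection

/-! ### Exponential moments of projected sub-Gaussian vectors. -/

section SubgaussianVector

open scoped NNReal ENNReal

/-! Comparing the criterion at `mhat` and at a fixed `m` leaves two noise terms. The one at `m` is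
at most a linear, hence centered, function of `ξ` (`inner_sub_starProjection_add_le`). The one at
`mhat` pairs `ξ` with a vector of `S (mhat ω) ⊔ ℝ ∙ f`; Young's inequality splits it into a fraction
`K⁻¹` of the loss and `K` times the squared projection of `ξ` onto that space
(`two_mul_inner_starProjection_sub_le`).

The penalty pays for this squared projection up to an excess. As `mhat` is random, the excess is
bounded by the sum over all models of the positive parts, whose expectation is of order `σ² Σ`
(`lintegral_norm_starProjection_sq_sub_le`). This rests on
`lintegral_exp_mul_norm_starProjection_sq_le`: `exp (t |Πξ|²)` is a Gaussian average of exponentials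
of linear forms in `ξ`, and these depend only on Euclidean norms, so no basis is privileged. -/

theorem lintegral_pi_prod_ofReal {ι : Type*} [Fintype ι] {f : ι → ℝ → ℝ} {μ : Measure ℝ}
    [SigmaFinite μ] (hf : ∀ i, Integrable (f i) μ) (hf0 : ∀ i x, 0 ≤ f i x) :
    ∫⁻ x : ι → ℝ, ENNReal.ofReal (∏ i, f i (x i)) ∂(Measure.pi fun _ => μ)
      = ENNReal.ofReal (∏ i, ∫ x, f i x ∂μ) := by
  rw [← integral_fintype_prod_eq_prod, ofReal_integral_eq_lintegral_ofReal]
  · exact Integrable.fintype_prod hf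
  · exact ae_of_all _ fun x => Finset.prod_nonneg fun i _ => hf0 i _

theorem gaussianPDFReal_mul_exp_sq_div_four (x : ℝ) :
    gaussianPDFReal 0 1 x * Real.exp (x ^ 2 / 4)
      = (√(2 * Real.pi))⁻¹ * Real.exp (-(1 / 4) * x ^ 2) := by
  rw [gaussianPDFReal_def]
  simp only [NNReal.coe_one, mul_one, sub_zero]
  rw [mul_assoc, ← Real.exp_add]
  ring_nf

theorem integrable_exp_sq_div_four_gaussianReal :
    Integrable (fun x : ℝ => Real.exp (x ^ 2 / 4)) (gaussianReal 0 1) := by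
  rw [gaussianReal_of_var_ne_zero 0 one_ne_zero, integrable_withDensity_iff_integrable_smul'
    (measurable_gaussianPDF 0 1) (ae_of_all _ fun _ => gaussianPDF_lt_top)]
  simp only [toReal_gaussianPDF, smul_eq_mul, gaussianPDFReal_mul_exp_sq_div_four]
  exact (integrable_exp_neg_mul_sq (by norm_num)).const_mul _

theorem integral_exp_sq_div_four_gaussianReal :
    ∫ x : ℝ, Real.exp (x ^ 2 / 4) ∂(gaussianReal 0 1) = √2 := by
  rw [integral_gaussianReal_eq_integral_smul one_ne_zero]
  simp only [smul_eq_mul, gaussianPDFReal_mul_exp_sq_div_four]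
  rw [integral_const_mul, integral_gaussian, ← Real.sqrt_inv, ← Real.sqrt_mul (by positivity)]
  congr 1
  field_simp
  norm_num

theorem lintegral_pi_gaussianReal_exp_sum_mul {ι : Type*} [Fintype ι] (a : ι → ℝ) :
    ∫⁻ g : ι → ℝ, ENNReal.ofReal (Real.exp (∑ i, a i * g i))
        ∂(Measure.pi fun _ => gaussianReal 0 1)
      = ENNReal.ofReal (Real.exp ((∑ i, a i ^ 2) / 2)) := by
  simp_rw [Real.exp_sum]
  rw [lintegral_pi_prod_ofReal (f := fun i x => Real.exp (a i * x))
    (fun i => integrable_exp_mul_gaussianReal (a i)) (fun i x => (Real.exp_pos _).le)]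
  have h (i : ι) : ∫ x, Real.exp (a i * x) ∂(gaussianReal 0 1) = Real.exp (a i ^ 2 / 2) := by
    simpa [mgf] using congrFun (mgf_fun_id_gaussianReal (μ := 0) (v := 1)) (a i)
  simp_rw [h, ← Real.exp_sum, Finset.sum_div]

theorem lintegral_pi_gaussianReal_exp_sum_sq_div_four {ι : Type*} [Fintype ι] :
    ∫⁻ g : ι → ℝ, ENNReal.ofReal (Real.exp ((∑ i, g i ^ 2) / 4))
        ∂(Measure.pi fun _ => gaussianReal 0 1)
      = ENNReal.ofReal (√2 ^ Fintype.card ι) := by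
  simp_rw [Finset.sum_div, Real.exp_sum]
  rw [lintegral_pi_prod_ofReal (f := fun _ x => Real.exp (x ^ 2 / 4))
    (fun i => integrable_exp_sq_div_four_gaussianReal) (fun i x => (Real.exp_pos _).le)]
  simp [integral_exp_sq_div_four_gaussianReal]

variable {Ω : Type*} [MeasurableSpace Ω] {P : Measure Ω}

theorem ProbabilityTheory.HasSubgaussianMGF.lintegral_exp_le {X : Ω → ℝ} {c : ℝ≥0}
    (h : HasSubgaussianMGF X c P) :
    ∫⁻ ω, ENNReal.ofReal (Real.exp (X ω)) ∂P ≤ ENNReal.ofReal (Real.exp (c / 2)) := by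
  rw [← ofReal_integral_eq_lintegral_ofReal (by simpa using h.integrable_exp_mul 1)
    (ae_of_all _ fun _ => (Real.exp_pos _).le)]
  exact ENNReal.ofReal_le_ofReal (by simpa [mgf] using h.mgf_le 1)

/-- Since `1 + t m ≤ mgf t ≤ exp (c t² / 2)` with equality throughout at `t = 0`, the difference of
the outer terms is minimal there, and its derivative `-m` vanishes. -/
theorem ProbabilityTheory.HasSubgaussianMGF.integral_eq_zero [IsProbabilityMeasure P]
    {X : Ω → ℝ} {c : ℝ≥0} (h : HasSubgaussianMGF X c P) : ∫ ω, X ω ∂P = 0 := by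
  set m := ∫ ω, X ω ∂P
  have hle (t : ℝ) : 1 + t * m ≤ Real.exp (c * t ^ 2 / 2) := by
    refine le_trans ?_ (h.mgf_le t)
    calc 1 + t * m = ∫ ω, (1 + t * X ω) ∂P := by
          rw [integral_add (integrable_const _) (h.integrable.const_mul t), integral_const_mul]
          simp [m]
      _ ≤ mgf X P t := integral_mono ((integrable_const _).add (h.integrable.const_mul t))
          (h.integrable_exp_mul t) fun ω => by
            simpa [add_comm] using Real.add_one_le_exp (t * X ω)
  have hd : HasDerivAt (fun t : ℝ => Real.exp (c * t ^ 2 / 2) - (1 + t * m)) (-m) 0 := by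
    have h1 : HasDerivAt (fun t : ℝ => (c : ℝ) * t ^ 2 / 2) 0 0 := by
      simpa using ((hasDerivAt_pow 2 (0 : ℝ)).const_mul (c : ℝ)).div_const 2
    simpa using h1.exp.fun_sub (((hasDerivAt_id' (0 : ℝ)).mul_const m).const_add 1)
  have hmin : IsLocalMin (fun t : ℝ => Real.exp (c * t ^ 2 / 2) - (1 + t * m)) 0 :=
    Filter.Eventually.of_forall fun t => by simpa using hle t
  simpa using hmin.hasDerivAt_eq_zero hd

variable {E : Type*} [NormedAddCommGroup E] [InnerProductSpace ℝ E] [FiniteDimensional ℝ E]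
  [MeasurableSpace E] [BorelSpace E]

/-- The Laplace transform of the squared length of the projection of a sub-Gaussian vector,
obtained by averaging its linear Laplace transform over an independent Gaussian vector. -/
theorem lintegral_exp_mul_norm_starProjection_sq_le [IsProbabilityMeasure P] {X : Ω → E}
    (hX : AEMeasurable X P) {s : ℝ≥0}
    (h : ∀ v, HasSubgaussianMGF (fun ω => inner ℝ v (X ω)) (s * ‖v‖₊ ^ 2) P)
    (U : Submodule ℝ E) {t : ℝ} (ht : 0 ≤ t) (hts : 4 * t * s ≤ 1) :
    ∫⁻ ω, ENNReal.ofReal (Real.exp (t * ‖U.starProjection (X ω)‖ ^ 2)) ∂P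
      ≤ ENNReal.ofReal (√2 ^ Module.finrank ℝ U) := by
  let b := stdOrthonormalBasis ℝ U
  -- The scale `√(2 t)` makes the variance of `⟪V g, x⟫` under standard Gaussian `g` equal to `2 t
  -- |Πx|²`, so its exponential averages to `exp (t |Πx|²)`.
  let V : (Fin (Module.finrank ℝ U) → ℝ) → E := fun g => ((√(2 * t) • ∑ i, g i • b i : U) : E)
  have hV : Continuous V := by fun_prop
  have hVn (g) : ‖V g‖ ^ 2 = 2 * t * ∑ i, g i ^ 2 := by
    have h1 : ‖∑ i, g i • b i‖ ^ 2 = ∑ i, g i ^ 2 := by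
      rw [← real_inner_self_eq_norm_sq, b.orthonormal.inner_sum]
      simp [sq]
    change ‖√(2 * t) • ∑ i, g i • b i‖ ^ 2 = _
    rw [norm_smul, mul_pow, h1, Real.norm_eq_abs, sq_abs, Real.sq_sqrt (by positivity)]
  have hVi (g) (x : E) : inner ℝ (V g) x = ∑ i, (√(2 * t) * inner ℝ (b i : E) x) * g i := by
    simp only [V, Submodule.coe_smul, AddSubmonoidClass.coe_finsetSum, inner_smul_left,
      sum_inner, Finset.mul_sum]
    refine Finset.sum_congr rfl fun i _ => ?_
    simp; ring
  have hproj (x : E) : ∑ i, (√(2 * t) * inner ℝ (b i : E) x) ^ 2 / 2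
      = t * ‖U.starProjection x‖ ^ 2 := by
    have h1 : ‖U.starProjection x‖ ^ 2 = ∑ i, inner ℝ (b i : E) x ^ 2 := by
      rw [Submodule.starProjection_apply, Submodule.norm_coe, ← b.sum_sq_norm_inner_right]
      refine Finset.sum_congr rfl fun i _ => ?_
      rw [Real.norm_eq_abs, sq_abs, Submodule.inner_orthogonalProjectionOnto_eq_of_mem_left]
    rw [h1, Finset.mul_sum]
    refine Finset.sum_congr rfl fun i _ => ?_
    rw [mul_pow, Real.sq_sqrt (by positivity)]; ring
  calc ∫⁻ ω, ENNReal.ofReal (Real.exp (t * ‖U.starProjection (X ω)‖ ^ 2)) ∂P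
      = ∫⁻ ω, ∫⁻ g, ENNReal.ofReal (Real.exp (inner ℝ (V g) (X ω)))
          ∂(Measure.pi fun _ => gaussianReal 0 1) ∂P := by
        refine lintegral_congr fun ω => ?_
        simp_rw [hVi]
        rw [lintegral_pi_gaussianReal_exp_sum_mul, Finset.sum_div, hproj]
    _ = ∫⁻ g, ∫⁻ ω, ENNReal.ofReal (Real.exp (inner ℝ (V g) (X ω))) ∂P
          ∂(Measure.pi fun _ => gaussianReal 0 1) := by
        apply lintegral_lintegral_swap
        have h1 : AEMeasurable (fun p : Ω × (Fin (Module.finrank ℝ U) → ℝ) => X p.1)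
            (P.prod (Measure.pi fun _ => gaussianReal 0 1)) := hX.comp_fst
        have h2 : AEMeasurable (fun p : Ω × (Fin (Module.finrank ℝ U) → ℝ) => V p.2)
            (P.prod (Measure.pi fun _ => gaussianReal 0 1)) :=
          (hV.measurable.comp measurable_snd).aemeasurable
        exact (h2.inner h1).exp.ennreal_ofReal
    _ ≤ ∫⁻ g : Fin (Module.finrank ℝ U) → ℝ, ENNReal.ofReal (Real.exp ((∑ i, g i ^ 2) / 4))
          ∂(Measure.pi fun _ => gaussianReal 0 1) := by
        refine lintegral_mono fun g => (h (V g)).lintegral_exp_le.trans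
          (ENNReal.ofReal_le_ofReal (Real.exp_le_exp.2 ?_))
        -- The exponent is `s |V g|² / 2 = s t |g|²`, and `4 t s ≤ 1` brings it below `|g|² / 4`,
        -- whose Gaussian average is `√2` per coordinate.
        push_cast
        rw [hVn]
        nlinarith [Finset.sum_nonneg fun i (_ : i ∈ Finset.univ) => sq_nonneg (g i)]
    _ = _ := by rw [lintegral_pi_gaussianReal_exp_sum_sq_div_four, Fintype.card_fin]

end SubgaussianVector

/-! ### Excess over the penalty, and the deterministic comparison of models. -/

section ModelSelectionInequality

open scoped NNReal ENNReal

variable {Ω : Type*} [MeasurableSpace Ω] {P : Measure Ω} {E : Type*} [NormedAddCommGroup E] [InnerProductSpace ℝ E]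
  [FiniteDimensional ℝ E]

theorem ae_eq_zero_of_hasSubgaussianMGF_inner_zero {X : Ω → E}
    (h : ∀ v, HasSubgaussianMGF (fun ω => inner ℝ v (X ω)) 0 P) : ∀ᵐ ω ∂P, X ω = 0 := by
  let b := stdOrthonormalBasis ℝ E
  have h1 : ∀ᵐ ω ∂P, ∀ i, inner ℝ (b i) (X ω) = 0 :=
    ae_all_iff.2 fun i => (h (b i)).ae_eq_zero_of_hasSubgaussianMGF_zero
  filter_upwards [h1] with ω hω
  rw [← b.sum_repr' (X ω)]
  simp [hω]

theorem memLp_two_of_hasSubgaussianMGF_inner {X : Ω → E} {c : E → ℝ≥0}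
    (h : ∀ v, HasSubgaussianMGF (fun ω => inner ℝ v (X ω)) (c v) P) : MemLp X 2 P := by
  let b := stdOrthonormalBasis ℝ E
  have h1 : MemLp (fun ω => ∑ i, inner ℝ (b i) (X ω) • b i) 2 P :=
    memLp_finsetSum _ fun i _ => by
      have h2 : MemLp (fun ω => inner ℝ (b i) (X ω)) 2 P := by
        simpa using (h (b i)).memLp 2
      exact (ContinuousLinearMap.toSpanSingleton ℝ (b i)).comp_memLp' h2
  simpa only [b.sum_repr'] using h1

/-- The factor 2 absorbs the extra dimension created by adjoining `f` to a model, so that `D = 0` is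
covered. -/
theorem sqrt_two_pow_le {k D : ℕ} (hk : k ≤ D + 1) : √2 ^ k ≤ 2 * Real.exp D := by
  have h1 : (1 : ℝ) ≤ √2 := Real.one_le_sqrt.2 one_le_two
  have h2 : √2 ≤ 2 := by rw [Real.sqrt_le_left two_pos.le]; norm_num
  have h3 : (2 : ℝ) ≤ Real.exp 1 := by linarith [Real.add_one_le_exp (1 : ℝ)]
  calc √2 ^ k ≤ √2 ^ (D + 1) := pow_le_pow_right₀ h1 hk
    _ = √2 * √2 ^ D := by ring
    _ ≤ 2 * Real.exp 1 ^ D := by gcongr; exact h2.trans h3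
    _ = 2 * Real.exp D := by rw [← Real.exp_nat_mul, mul_one]

/-- `ENNReal.ofReal` takes the positive part. With `t = 1 / (4 s)` and `324 = 4 * 81`, the excess is
`4 s u` for `u = t |Πx|² - 81 (D + δ)`, and `u ≤ exp u` reduces it to the exponential moment. -/
theorem lintegral_norm_starProjection_sq_sub_le [IsProbabilityMeasure P] [MeasurableSpace E] [BorelSpace E]
    {X : Ω → E} (hX : AEMeasurable X P) {s : ℝ≥0}
    (h : ∀ v, HasSubgaussianMGF (fun ω => inner ℝ v (X ω)) (s * ‖v‖₊ ^ 2) P)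
    (U : Submodule ℝ E) {D : ℕ} (hU : Module.finrank ℝ U ≤ D + 1) {δ : ℝ} (hδ : 0 ≤ δ) :
    ∫⁻ ω, ENNReal.ofReal (‖U.starProjection (X ω)‖ ^ 2 - 324 * s * (D + δ)) ∂P
      ≤ ENNReal.ofReal (324 * s * Real.exp (-δ)) := by
  -- Degenerate noise is treated apart because `t = 1 / (4 s)` needs `s ≠ 0`.
  rcases eq_or_ne s 0 with rfl | hs
  · have h0 := ae_eq_zero_of_hasSubgaussianMGF_inner_zero (by simpa using h)
    rw [lintegral_congr_ae (g := 0)]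
    · simp
    · filter_upwards [h0] with ω hω
      simp [hω]
  have hs0 : (0 : ℝ) < s := by exact_mod_cast pos_iff_ne_zero.2 hs
  have hD : (0 : ℝ) ≤ D := D.cast_nonneg
  let t : ℝ := 1 / (4 * s)
  have ht : 0 < t := by positivity
  have hts : 4 * t * s = 1 := by simp only [t]; field_simp
  set C : ℝ := 4 * s * Real.exp (-(81 * (D + δ))) with hC
  calc ∫⁻ ω, ENNReal.ofReal (‖U.starProjection (X ω)‖ ^ 2 - 324 * s * (D + δ)) ∂P
      ≤ ∫⁻ ω, ENNReal.ofReal C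
          * ENNReal.ofReal (Real.exp (t * ‖U.starProjection (X ω)‖ ^ 2)) ∂P := by
        refine lintegral_mono fun ω => ?_
        rw [← ENNReal.ofReal_mul (by positivity)]
        refine ENNReal.ofReal_le_ofReal ?_
        set z := ‖U.starProjection (X ω)‖ ^ 2
        have h1 := Real.add_one_le_exp (-(81 * (D + δ)) + t * z)
        rw [hC, mul_assoc (4 * (s : ℝ)), ← Real.exp_add]
        calc z - 324 * s * (D + δ) = 4 * s * (-(81 * (D + δ)) + t * z) := by
              linear_combination (-z) * hts
          _ ≤ _ := by gcongr; linarith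
    _ ≤ ENNReal.ofReal C * ENNReal.ofReal (√2 ^ Module.finrank ℝ U) := by
        rw [lintegral_const_mul' _ _ ENNReal.ofReal_ne_top]
        gcongr
        exact lintegral_exp_mul_norm_starProjection_sq_le hX h U ht.le hts.le
    _ ≤ ENNReal.ofReal (324 * s * Real.exp (-δ)) := by
        rw [← ENNReal.ofReal_mul (by positivity)]
        refine ENNReal.ofReal_le_ofReal ?_
        calc C * √2 ^ Module.finrank ℝ U ≤ C * (2 * Real.exp D) := by
              gcongr; exact sqrt_two_pow_le hU
          _ = 8 * s * Real.exp (-(81 * (D + δ)) + D) := by rw [hC, Real.exp_add]; ring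
          _ ≤ 324 * s * Real.exp (-δ) := by
              gcongr
              · norm_num
              · linarith

/-- The discarded term `⟪x, Πx⟫` is nonnegative; what remains is linear in `x`, so it has zero mean.
-/
theorem inner_sub_starProjection_add_le (S : Submodule ℝ E) (f x : E) :
    inner ℝ x (f - S.starProjection (f + x)) ≤ inner ℝ x (f - S.starProjection f) := by
  have h : 0 ≤ inner ℝ x (S.starProjection x) := by
    rw [real_inner_comm]; exact S.re_inner_starProjection_nonneg x
  rw [map_add, ← sub_sub, inner_sub_right]
  linarith

theorem two_mul_inner_starProjection_sub_le (S : Submodule ℝ E) (f x : E) {K : ℝ} (hK : 0 < K) :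
    2 * inner ℝ x (S.starProjection (f + x) - f)
      ≤ K⁻¹ * ‖f - S.starProjection (f + x)‖ ^ 2
        + K * ‖(S ⊔ ℝ ∙ f).starProjection x‖ ^ 2 := by
  set U := S ⊔ ℝ ∙ f
  set w := S.starProjection (f + x) - f with hw
  have hwU : w ∈ U := U.sub_mem
    ((le_sup_left : S ≤ U) (S.starProjection_apply_mem _))
    ((le_sup_right : ℝ ∙ f ≤ U) (Submodule.mem_span_singleton_self f))
  have h1 : inner ℝ x w = inner ℝ (U.starProjection x) w := by
    rw [U.inner_starProjection_left_eq_right, U.starProjection_eq_self_iff.2 hwU]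
  have h2 := real_inner_le_norm (U.starProjection x) w
  rw [h1, norm_sub_rev, ← hw]
  have h3 : 0 ≤ K⁻¹ * (‖w‖ - K * ‖U.starProjection x‖) ^ 2 := by positivity
  have h4 : K⁻¹ * (‖w‖ - K * ‖U.starProjection x‖) ^ 2 = K⁻¹ * ‖w‖ ^ 2
      - 2 * (‖U.starProjection x‖ * ‖w‖) + K * ‖U.starProjection x‖ ^ 2 := by
    field_simp
    ring
  linarith

theorem finrank_sup_span_singleton_le (S : Submodule ℝ E) (f : E) :
    Module.finrank ℝ (S ⊔ ℝ ∙ f : Submodule ℝ E) ≤ Module.finrank ℝ S + 1 := by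
  have h1 := Submodule.finrank_add_le_finrank_add_finrank S (ℝ ∙ f)
  have h2 : Module.finrank ℝ (ℝ ∙ f) ≤ 1 := by simpa using finrank_span_le_card (R := ℝ) {f}
  omega

theorem norm_sub_starProjection_sq_le_of_penalized_le {S S' : Submodule ℝ E} {f x : E}
    {K p p' : ℝ} (hK : 0 < K)
    (h : ‖f + x - S'.starProjection (f + x)‖ ^ 2 + p'
      ≤ ‖f + x - S.starProjection (f + x)‖ ^ 2 + p) :
    (1 - K⁻¹) * ‖f - S'.starProjection (f + x)‖ ^ 2
      ≤ ‖f - S.starProjection (f + x)‖ ^ 2 + 2 * inner ℝ x (f - S.starProjection f) + p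
        + (K * ‖(S' ⊔ ℝ ∙ f).starProjection x‖ ^ 2 - p') := by
  have hexp (q : E) : ‖f + x - q‖ ^ 2 = ‖f - q‖ ^ 2 + 2 * inner ℝ x (f - q) + ‖x‖ ^ 2 := by
    rw [add_sub_right_comm, norm_add_sq_real, real_inner_comm]
  rw [hexp, hexp] at h
  have h1 := inner_sub_starProjection_add_le S f x
  have h2 := two_mul_inner_starProjection_sub_le S' f x hK
  rw [← neg_sub f, inner_neg_right] at h2
  linarith

/-! ### Risk bound for the selected estimator. -/

theorem penalized_risk_bound [IsProbabilityMeasure P] [MeasurableSpace E] [BorelSpace E]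
    {X : Ω → E} {s : ℝ≥0} (h : ∀ v, HasSubgaussianMGF (fun ω => inner ℝ v (X ω)) (s * ‖v‖₊ ^ 2) P) (f : E)
    {M : Type*} {S : M → Submodule ℝ E} {Δ : M → ℝ} (hΔ : ∀ m, 0 ≤ Δ m)
    (hΔ_sum : Summable fun m => Real.exp (-Δ m)) {K : ℝ} (hK : 1 < K) {pen : M → ℝ}
    (hpen : ∀ m, K * (324 * s * (Module.finrank ℝ (S m) + Δ m)) ≤ pen m) {mhat : Ω → M}
    (hmeas : AEMeasurable (fun ω => (S (mhat ω)).starProjection (f + X ω)) P)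
    (hmhat : ∀ᵐ ω ∂P, ∀ m,
      ‖f + X ω - (S (mhat ω)).starProjection (f + X ω)‖ ^ 2 + pen (mhat ω)
        ≤ ‖f + X ω - (S m).starProjection (f + X ω)‖ ^ 2 + pen m) :
    (∀ m, Integrable (fun ω => ‖f - (S m).starProjection (f + X ω)‖ ^ 2) P) ∧
    Integrable (fun ω => ‖f - (S (mhat ω)).starProjection (f + X ω)‖ ^ 2) P ∧
    ∀ m, (1 - K⁻¹) * ∫ ω, ‖f - (S (mhat ω)).starProjection (f + X ω)‖ ^ 2 ∂P
      ≤ (∫ ω, ‖f - (S m).starProjection (f + X ω)‖ ^ 2 ∂P) + pen m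
        + K * (324 * s * ∑' m, Real.exp (-Δ m)) := by
  have hX2 : MemLp X 2 P := memLp_two_of_hasSubgaussianMGF_inner h
  have hX : AEMeasurable X P := hX2.aestronglyMeasurable.aemeasurable
  have hK0 : 0 < K := by linarith
  have hK1 : 0 < 1 - K⁻¹ := sub_pos.2 (inv_lt_one_of_one_lt₀ hK)
  have hInt (m) : Integrable (fun ω => ‖f - (S m).starProjection (f + X ω)‖ ^ 2) P := by
    have h1 : MemLp (fun ω => f - (S m).starProjection (f + X ω)) 2 P :=
      (memLp_const f).sub ((S m).starProjection.comp_memLp' ((memLp_const f).add hX2))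
    simpa using h1.integrable_norm_pow two_ne_zero
  -- `exp (-Δ m)` never vanishes, so the support of this summable family is all of `M`; countability
  -- gives measurability of `G` and the exchange of sum and integral.
  have : Countable M := by
    rw [← Set.countable_univ_iff]
    convert hΔ_sum.countable_support
    ext m
    simp [(Real.exp_pos _).ne']
  let Z : M → Ω → ℝ := fun m ω => ‖(S m ⊔ ℝ ∙ f).starProjection (X ω)‖ ^ 2
    - 324 * s * (Module.finrank ℝ (S m) + Δ m)
  let G : Ω → ℝ≥0∞ := fun ω => ∑' m, ENNReal.ofReal (Z m ω)
  have hZ (m) : AEMeasurable (Z m) P :=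
    (((S m ⊔ ℝ ∙ f).starProjection.continuous.measurable.comp_aemeasurable hX).norm.pow_const
      2).sub_const _
  have hG : AEMeasurable G P := AEMeasurable.tsum fun m => (hZ m).ennreal_ofReal
  have hsum : Summable fun m => 324 * (s : ℝ) * Real.exp (-Δ m) := hΔ_sum.mul_left _
  have hGle : ∫⁻ ω, G ω ∂P ≤ ENNReal.ofReal (324 * s * ∑' m, Real.exp (-Δ m)) := by
    rw [lintegral_tsum fun m => (hZ m).ennreal_ofReal, ← tsum_mul_left,
      ENNReal.ofReal_tsum_of_nonneg (fun m => by positivity) hsum]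
    exact ENNReal.tsum_le_tsum fun m => lintegral_norm_starProjection_sq_sub_le hX h _
      (finrank_sup_span_singleton_le _ _) (hΔ m)
  have hGtop : ∫⁻ ω, G ω ∂P ≠ ∞ := ne_top_of_le_ne_top ENNReal.ofReal_ne_top hGle
  have hGint : Integrable (fun ω => (G ω).toReal) P := integrable_toReal_of_lintegral_ne_top hG hGtop
  have hGI : ∫ ω, (G ω).toReal ∂P ≤ 324 * s * ∑' m, Real.exp (-Δ m) := by
    rw [integral_toReal hG (ae_lt_top' hG hGtop)]
    exact ENNReal.toReal_le_of_le_ofReal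
      (mul_nonneg (by positivity) (tsum_nonneg fun m => (Real.exp_pos _).le)) hGle
  let W : M → Ω → ℝ := fun m ω => ‖f - (S m).starProjection (f + X ω)‖ ^ 2
    + 2 * inner ℝ (f - (S m).starProjection f) (X ω) + pen m + K * (G ω).toReal
  have hinner (v : E) : Integrable (fun ω => 2 * inner ℝ v (X ω)) P :=
    (h v).integrable.const_mul 2
  have hW₁ (m) : Integrable (fun ω => ‖f - (S m).starProjection (f + X ω)‖ ^ 2
      + 2 * inner ℝ (f - (S m).starProjection f) (X ω)) P := (hInt m).add (hinner _)
  have hW₂ (m) : Integrable (fun ω => ‖f - (S m).starProjection (f + X ω)‖ ^ 2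
      + 2 * inner ℝ (f - (S m).starProjection f) (X ω) + pen m) P :=
    (hW₁ m).add (integrable_const _)
  have hW (m) : Integrable (W m) P := (hW₂ m).add (hGint.const_mul K)
  have hWI (m) : ∫ ω, W m ω ∂P = (∫ ω, ‖f - (S m).starProjection (f + X ω)‖ ^ 2 ∂P) + pen m
      + K * ∫ ω, (G ω).toReal ∂P := by
    rw [integral_add (hW₂ m) (hGint.const_mul K), integral_add (hW₁ m) (integrable_const _),
      integral_add (hInt m) (hinner _), integral_const_mul, integral_const_mul,
      (h _).integral_eq_zero]
    simp
  have hle : ∀ᵐ ω ∂P, ∀ m,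
      (1 - K⁻¹) * ‖f - (S (mhat ω)).starProjection (f + X ω)‖ ^ 2 ≤ W m ω := by
    filter_upwards [hmhat, ae_lt_top' hG hGtop] with ω hω hGω m
    refine (norm_sub_starProjection_sq_le_of_penalized_le hK0 (hω m)).trans ?_
    rw [real_inner_comm]
    -- One term of the sum of positive parts; finiteness of `G ω` matters since `toReal` sends `∞`
    -- to 0.
    have h1 : Z (mhat ω) ω ≤ (G ω).toReal :=
      (Real.le_coe_toNNReal _).trans
        (ENNReal.toReal_mono hGω.ne (ENNReal.le_tsum (mhat ω)))
    have h2 := mul_le_mul_of_nonneg_left h1 hK0.le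
    have h3 := hpen (mhat ω)
    simp only [Z, mul_sub] at h2
    simp only [W]
    linarith
  have : Nonempty M := P.nonempty_of_neZero.map mhat
  have hhat : Integrable (fun ω => ‖f - (S (mhat ω)).starProjection (f + X ω)‖ ^ 2) P := by
    obtain ⟨m⟩ := this
    refine ((hW m).const_mul (1 - K⁻¹)⁻¹).mono'
      (((aemeasurable_const.sub hmeas).norm.pow_const 2).aestronglyMeasurable) ?_
    filter_upwards [hle] with ω hω
    rw [Real.norm_of_nonneg (by positivity), le_inv_mul_iff₀ hK1]
    exact hω m
  refine ⟨hInt, hhat, fun m => ?_⟩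
  rw [← integral_const_mul]
  calc _ ≤ ∫ ω, W m ω ∂P := integral_mono_ae (hhat.const_mul _) (hW m)
        (hle.mono fun ω hω => hω m)
    _ ≤ _ := by rw [hWI]; gcongr

/-! ### From independent coordinates to the noise vector, and the final constants. -/

namespace ModelSelection

theorem LaplaceBound.hasSubgaussianMGF [IsProbabilityMeasure P] {X : Ω → ℝ} {σ : ℝ}
    (h : LaplaceBound P X σ 0) :
    HasSubgaussianMGF X (σ ^ 2).toNNReal P where
  integrable_exp_mul t := (h t (by simp)).1
  mgf_le t := by
    obtain ⟨h1, h2⟩ := h t (by simp)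
    have h3 : 0 < ∫ ω, Real.exp (t * X ω) ∂P := integral_exp_pos h1
    rw [Real.log_le_iff_le_exp h3] at h2
    rw [Real.coe_toNNReal _ (sq_nonneg σ)]
    refine h2.trans_eq ?_
    congr 1
    simp only [mul_zero, sub_zero, mul_one]
    ring

theorem hasSubgaussianMGF_inner {n : ℕ} {ξ : Fin n → Ω → ℝ} (hξ : iIndepFun ξ P) {c : ℝ≥0}
    (h : ∀ i, HasSubgaussianMGF (ξ i) c P) (v : EuclideanSpace ℝ (Fin n)) :
    HasSubgaussianMGF (fun ω => inner ℝ v (WithLp.toLp 2 fun i => ξ i ω : EuclideanSpace ℝ (Fin n)))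
      (c * ‖v‖₊ ^ 2) P := by
  have h1 : iIndepFun (fun i ω => v i * ξ i ω) P :=
    hξ.comp (fun i x => v i * x) fun i => measurable_const_mul _
  have h2 := HasSubgaussianMGF.sum_of_iIndepFun h1 (s := Finset.univ)
    fun i _ => (h i).const_mul (v i)
  convert h2 using 1
  · ext ω
    simp [PiLp.inner_apply, mul_comm]
  · rw [← NNReal.coe_inj]
    push_cast
    rw [EuclideanSpace.real_norm_sq_eq, Finset.mul_sum]
    exact Finset.sum_congr rfl fun i _ => mul_comm _ _

end ModelSelection

/-- Dividing by `1 - K⁻¹` gives the sharper constants `K / (K - 1)` and `K² / (K - 1)`; they are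
then weakened, the first because `(K - 1)² ≤ K² + K - 1`. -/
theorem oracle_constants_le {K : ℝ} (hK : 1 < K) {A T R : ℝ} (hT : 0 ≤ T) (hR : 0 ≤ R)
    (h : (1 - K⁻¹) * A ≤ T + K * R) :
    A ≤ K * (K ^ 2 + K - 1) / (K - 1) ^ 3 * T + K ^ 3 / (K - 1) ^ 2 * R := by
  have hK1 : 0 < K - 1 := by linarith
  have h1 : (K - 1) * A ≤ K * T + K ^ 2 * R := by
    have := mul_le_mul_of_nonneg_left h (by linarith : 0 ≤ K)
    have h2 : K * ((1 - K⁻¹) * A) = (K - 1) * A := by field_simp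
    linarith
  have h2 : A ≤ K / (K - 1) * T + K ^ 2 / (K - 1) * R := by
    rw [← mul_le_mul_iff_right₀ hK1]
    refine h1.trans_eq ?_
    field_simp
  refine h2.trans ?_
  gcongr ?_ * T + ?_ * R
  · rw [div_le_div_iff₀ hK1 (by positivity)]
    have : 0 ≤ K * (K - 1) * (3 * K - 2) := by
      have : 0 ≤ 3 * K - 2 := by linarith
      positivity
    nlinarith
  · rw [div_le_div_iff₀ hK1 (by positivity)]
    have : 0 ≤ K ^ 2 * (K - 1) := by positivity
    nlinarith

end ModelSelectionInequality

theorem mainTheorem8 {Ω : Type*} [MeasurableSpace Ω] (P : Measure Ω) [IsProbabilityMeasure P]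
    {n : ℕ} (f : EuclideanSpace ℝ (Fin n)) (ξ : Fin n → Ω → ℝ)
    (hξ_meas : ∀ i, AEMeasurable (ξ i) P)
    (hξ_indep : iIndepFun ξ P)
    (σ : ℝ) (hσ : 0 ≤ σ)
    (hξ_laplace : ∀ i, ModelSelection.LaplaceBound P (ξ i) σ 0)
    {M : Type*} (S : M → Submodule ℝ (EuclideanSpace ℝ (Fin n)))
    (Δ : M → ℝ) (hΔ : ∀ m, 0 ≤ Δ m) (hΔ_sum : Summable (fun m => Real.exp (-Δ m)))
    (K : ℝ) (hK : 1 < K) (pen : M → ℝ)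
    (hpen : ∀ m, K * ModelSelection.kappa ^ 2 * σ ^ 2 * (Module.finrank ℝ (S m) + Δ m) ≤ pen m)
    (mhat : Ω → M)
    (hmhat_meas :
      AEMeasurable (fun ω => ModelSelection.lse (S (mhat ω)) (ModelSelection.obs f ξ ω)) P)
    (hmhat : ∀ᵐ ω ∂P, ∀ m,
      ModelSelection.crit S pen (ModelSelection.obs f ξ ω) (mhat ω)
        ≤ ModelSelection.crit S pen (ModelSelection.obs f ξ ω) m) :
    (∀ m, Integrable
      (fun ω => ‖f - ModelSelection.lse (S m) (ModelSelection.obs f ξ ω)‖ ^ 2) P) ∧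
    Integrable
      (fun ω => ‖f - ModelSelection.lse (S (mhat ω)) (ModelSelection.obs f ξ ω)‖ ^ 2) P ∧
    ∫ ω, ‖f - ModelSelection.lse (S (mhat ω)) (ModelSelection.obs f ξ ω)‖ ^ 2 ∂P
      ≤ K * (K ^ 2 + K - 1) / (K - 1) ^ 3 *
          (⨅ m, ((∫ ω, ‖f - ModelSelection.lse (S m) (ModelSelection.obs f ξ ω)‖ ^ 2 ∂P) + pen m))
        + K ^ 3 / (K - 1) ^ 2 * ModelSelection.kappa ^ 2 * σ ^ 2 * ∑' m, Real.exp (-Δ m) := by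
  have hobs (ω) : ModelSelection.obs f ξ ω = f + WithLp.toLp 2 fun i => ξ i ω := rfl
  have hs : (((σ ^ 2).toNNReal : NNReal) : ℝ) = σ ^ 2 := Real.coe_toNNReal _ (sq_nonneg σ)
  have hpen0 (m) : 0 ≤ pen m := by
    refine le_trans ?_ (hpen m)
    have := hΔ m
    positivity
  simp only [ModelSelection.lse, ModelSelection.crit, hobs] at hmhat_meas hmhat ⊢
  obtain ⟨h1, h2, h3⟩ := penalized_risk_bound
    (ModelSelection.hasSubgaussianMGF_inner hξ_indep fun i => (hξ_laplace i).hasSubgaussianMGF)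
    f hΔ hΔ_sum hK
    (fun m => le_trans (le_of_eq (by rw [hs, ModelSelection.kappa]; ring)) (hpen m))
    hmhat_meas hmhat
  refine ⟨h1, h2, ?_⟩
  have : Nonempty M := P.nonempty_of_neZero.map mhat
  have hC : 0 < K * (K ^ 2 + K - 1) / (K - 1) ^ 3 := by
    have h4 : 0 < K - 1 := by linarith
    have h5 : 0 < K ^ 2 + K - 1 := by nlinarith
    positivity
  -- Isolating the infimum turns the goal into a lower bound to be checked model by model.
  rw [← sub_le_iff_le_add, ← div_le_iff₀' hC]
  refine le_ciInf fun m => ?_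
  rw [div_le_iff₀' hC, sub_le_iff_le_add]
  refine (oracle_constants_le hK (add_nonneg (integral_nonneg fun ω => by positivity) (hpen0 m))
    (mul_nonneg (by positivity) (tsum_nonneg fun m => (Real.exp_pos _).le)) (h3 m)).trans_eq ?_
  rw [hs, ModelSelection.kappa]
  ring
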